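/- Let $G$ be a finite connected undirected simple graph on $N$ nodes, let $\mathcal N_i$ be the set of neighbors of node $i$, let $\rho>0$ and $\Delta>0$, let $r_1,\dots,r_N\in\mathbb R$ be the local data, and put $x_{\mathrm{avg}}=\frac1N\sum_{i=1}^N r_i$. For $y\in[t\Delta,(t+1)\Delta)$ with $t\in\mathbb Z$, the probabilistic quantizer takes the random value $$Q_p(y)=\begin{cases} t\Delta & \text{with probability } t+1-\frac{y}{\Delta},\\ (t+1)\Delta & \text{with probability } \frac{y}{\Delta}-t.\end{cases}$$ Let $M_-$ be the oriented incidence matrix of $G$: its columns are indexed by the arcs (ordered pairs $(i,j)$ of adjacent nodes), and the column of $(i,j)$ has entry $1$ in row $i$, entry $-1$ in row $j$, and $0$ elsewhere. Let $x^0\in\mathbb R^N$ be arbitrary, and let $\alpha^0\in\mathbb R^N$ lie in the column space of $M_-M_-^T$. Consider the probabilistically quantized consensus ADMM (PQ-CADMM), that is, random variables $x_i^k,\alpha_i^k,q_i^k$ ($k\ge0$, $1\le i\le N$) on a probability space, with the given deterministic initial values $x^0,\alpha^0$, such that for all $k\ge 0$ and all $i$ $$x_i^{k+1}=\frac{1}{1+2\rho|\mathcal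 N_i|}\Big(\rho|\mathcal N_i|\,q_i^k+\rho\sum_{j\in\mathcal N_i}q_j^k-\alpha_i^k+r_i\Big),$$ $$\alpha_i^{k+1}=\alpha_i^k+\rho\Big(|\mathcal N_i|\,q_i^{k+1}-\sum_{j\in\mathcal N_i}q_j^{k+1}\Big),$$ where $q_i^k$ is the probabilistic quantization of $x_i^k$: conditionally on all quantized values $q_j^l$ with $l<k$, the variable $q_i^k$ has the law of $Q_p(x_i^k)$. (The quantizations at different nodes at the same time may, but need not, be independent.) Then for every node $i$ the running average $\bar x_i^k=\frac1k\sum_{l=1}^k x_i^l$, $k\ge1$, satisfies $$\mathbb P\Big[\lim_{k\to\infty}\bar x_i^k=x_{\mathrm{avg}}\Big]=1.$$ -/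

import Mathlib

open MeasureTheory Filter Topology
open scoped ProbabilityTheory

namespace PQCADMM

section Network

variable {V : Type*} [DecidableEq V] (G : SimpleGraph V)

/-- The arc-node matrix `A₁`: the entry at the arc `(i, j)` and the node `i` is `1`, all other
entries are `0`. The arcs of the network are the darts of the graph, two for each edge. -/
def sourceMatrix : Matrix G.Dart V ℝ :=
  Matrix.of fun d i => if d.fst = i then 1 else 0

/-- The arc-node matrix `A₂`: the entry at the arc `(i, j)` and the node `j` is `1`, all other
entries are `0`. -/
def targetMatrix : Matrix G.Dart V ℝ :=
  Matrix.of fun d i => if d.snd = i then 1 else 0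

/-- The oriented incidence matrix `M₋ = A₁ᵀ - A₂ᵀ`. -/
def orientedIncidence : Matrix V G.Dart ℝ :=
  (sourceMatrix G).transpose - (targetMatrix G).transpose

/-- The initialization condition on `α⁰`: it lies in the column space of `M₋ M₋ᵀ`
(there is no condition on `x⁰`). -/
def InitCondition [Fintype V] [DecidableRel G.Adj] (α₀ : V → ℝ) : Prop :=
  α₀ ∈ LinearMap.range
    (orientedIncidence G * (orientedIncidence G).transpose).mulVecLin

end Network

/-- The law of the probabilistic quantizer with resolution `Δ` at the input `y`: for
`y ∈ [tΔ, (t+1)Δ)`, `t` an integer, it takes the value `tΔ` with probability `t + 1 - y/Δ` and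
the value `(t+1)Δ` with probability `y/Δ - t`. -/
noncomputable def quantLaw (Δ y : ℝ) : Measure ℝ :=
  ENNReal.ofReal ((⌊y / Δ⌋ : ℝ) + 1 - y / Δ) • Measure.dirac ((⌊y / Δ⌋ : ℝ) * Δ) +
    ENNReal.ofReal (y / Δ - (⌊y / Δ⌋ : ℝ)) • Measure.dirac (((⌊y / Δ⌋ : ℝ) + 1) * Δ)

/-- The history before the quantizations at time `k`: the σ-algebra generated by all quantized
values `q l j` at times `l < k`. When the initial values are deterministic, this is all the
randomness that enters the variables at time `k`. -/
@[reducible] def history {V Ω : Type*} (q : ℕ → V → Ω → ℝ) (k : ℕ) : MeasurableSpace Ω :=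
  ⨆ (l : ℕ) (_ : l < k) (j : V), MeasurableSpace.comap (q l j) inferInstance

/-- `x`, `α`, `q` are the local variables, the dual variables and the quantized local variables
of a run of the probabilistically quantized consensus ADMM on the network `G`, with algorithm
parameter `ρ`, quantization resolution `Δ`, local data `r` and initial values `x₀`, `α₀`.
The number `q k i` is the quantized value of `x k i` (one random value, used by node `i` and
by all its neighbors, in both updates). -/
structure IsPQCADMM {V : Type*} [Fintype V] (G : SimpleGraph V) [DecidableRel G.Adj]
    {Ω : Type*} [MeasurableSpace Ω] (P : Measure Ω) (ρ Δ : ℝ) (r x₀ α₀ : V → ℝ)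
    (x α q : ℕ → V → Ω → ℝ) : Prop where
  measurable_quant : ∀ k i, Measurable (q k i)
  x_zero : ∀ i ω, x 0 i ω = x₀ i
  α_zero : ∀ i ω, α 0 i ω = α₀ i
  x_succ : ∀ k i ω, x (k + 1) i ω =
    1 / (1 + 2 * ρ * (G.degree i : ℝ)) *
      (ρ * (G.degree i : ℝ) * q k i ω + ρ * ∑ j ∈ G.neighborFinset i, q k j ω
        - α k i ω + r i)
  α_succ : ∀ k i ω, α (k + 1) i ω =
    α k i ω + ρ * ((G.degree i : ℝ) * q (k + 1) i ω
      - ∑ j ∈ G.neighborFinset i, q (k + 1) j ω)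
  /-- Given the history, `q k i` has the law of the probabilistic quantizer at `x k i`. -/
  quant_law : ∀ k i, ∀ B : Set ℝ, MeasurableSet B →
    P⟦q k i ⁻¹' B | history q k⟧ =ᵐ[P] fun ω => (quantLaw Δ (x k i ω)).real B

end PQCADMM

/-!
Write `e k = q k - x k` for the quantization errors. They are bounded by `Δ` and form a martingale
difference sequence for the history filtration, so their time averages tend to zero almost surely
(`ae_tendsto_average_zero_of_martingaleDifference`). Everything else is a pathwise argument that
uses only `|e k| ≤ Δ` and the vanishing of these averages.

*Boundedness.* By induction `α k = α₀ + L β k` with `β k = ρ (q 1 + ⋯ + q k)` and `L` the graph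
Laplacian, so a run is a linear recursion in the state `(q k, β k)`, driven by the bounded errors.
With `S q = (q i - q j)` and `T q = (q i + q j)` on the arcs `(i, j)`, the quadratic form
`energy = ρ/2 ‖T q‖² + 1/(2ρ) ‖S β‖²` decreases in a step without error, up to a constant, by
`‖x (k+1)‖²` (`energy_update_le`). Two consecutive values of `x` control the whole energy
(`exists_energy_le`), so two steps contract it up to a constant, and `x k` and `S (β k)` stay within
a nonrandom bound (`exists_bound_of_weakUpdate`). This bound also makes the variables `x k`
integrable and lets `q k` take only finitely many values, which is what the computation of the
conditional mean of `e k` uses (`condExp_quantized_sub_eq_zero`).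

*Averages.* Since `S (β n)` is bounded, the averages of `q` at adjacent nodes, hence at all nodes of
the connected graph, become equal. As `α₀` lies in the column space of `M₋ M₋ᵀ`, the sum of the
`α k i` over `i` is zero. Summing the `x`-update over the nodes then shows that the sum of the
averages of `x` tends to the sum of the data (`tendsto_average_of_update`).
-/

namespace PQCADMM

/-! ### Energy decay of the ADMM recursion -/

section Energy

variable {H F : Type*} [NormedAddCommGroup H] [InnerProductSpace ℝ H]
  [NormedAddCommGroup F] [InnerProductSpace ℝ F]

/-- The energy of the state `(q, β)` of the recursion: the quadratic form that decreases along the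
updates. -/
noncomputable def energy (ρ : ℝ) (S T : H →L[ℝ] F) (q β : H) : ℝ :=
  ρ / 2 * ‖T q‖ ^ 2 + 1 / (2 * ρ) * ‖S β‖ ^ 2

/-- The local variable `x'` is the update of the state `(q, β)` with forcing `f`, in weak form: the
equation `x' + ρ/2 (SᵀS + TᵀT) x' = ρ/2 TᵀT q - 1/2 SᵀS β + f`, tested against every vector. -/
def WeakUpdate (ρ : ℝ) (S T : H →L[ℝ] F) (f x' q β : H) : Prop :=
  ∀ h : H, inner ℝ x' h + ρ / 2 * (inner ℝ (S x') (S h) + inner ℝ (T x') (T h)) =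
    ρ / 2 * inner ℝ (T q) (T h) - 1 / 2 * inner ℝ (S β) (S h) + inner ℝ f h

lemma energy_nonneg {ρ : ℝ} (hρ : 0 < ρ) (S T : H →L[ℝ] F) (q β : H) :
    0 ≤ energy ρ S T q β := by
  unfold energy; positivity

/-- The energy decay, obtained by testing the update equation against `x'` itself. Here
`ρ • x'` is the increment of `β` in the absence of quantization errors. -/
lemma energy_update_le {ρ : ℝ} (hρ : 0 < ρ) {S T : H →L[ℝ] F} {f x' q β : H}
    (hx : WeakUpdate ρ S T f x' q β) :
    energy ρ S T x' (β + ρ • x') ≤ energy ρ S T q β + ‖f‖ ^ 2 - ‖x'‖ ^ 2 := by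
  have h1 := hx x'
  have h2 : ‖S (β + ρ • x')‖ ^ 2 =
      ‖S β‖ ^ 2 + 2 * ρ * inner ℝ (S β) (S x') + ρ ^ 2 * ‖S x'‖ ^ 2 := by
    rw [map_add, map_smul, norm_add_sq_real, inner_smul_right, norm_smul, mul_pow,
      Real.norm_eq_abs, sq_abs]
    ring
  have h3 := norm_sub_sq_real (T q) (T x')
  have h4 := norm_sub_sq_real f x'
  simp only [real_inner_self_eq_norm_sq] at h1
  unfold energy
  rw [h2]
  have h5 : 1 / (2 * ρ) * (‖S β‖ ^ 2 + 2 * ρ * inner ℝ (S β) (S x') + ρ ^ 2 * ‖S x'‖ ^ 2) =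
      1 / (2 * ρ) * ‖S β‖ ^ 2 + inner ℝ (S β) (S x') + ρ / 2 * ‖S x'‖ ^ 2 := by
    field_simp
  have h6 : 0 ≤ ρ / 2 * ‖T q - T x'‖ ^ 2 := by positivity
  have h7 : 0 ≤ ρ / 2 * ‖S x'‖ ^ 2 := by positivity
  have h8 : 0 ≤ ‖f - x'‖ ^ 2 := by positivity
  rw [h5]
  rw [h3] at h6
  rw [h4] at h8
  nlinarith

lemma norm_add_sq_le_weighted {E : Type*} [NormedAddCommGroup E] [InnerProductSpace ℝ E]
    (a b : E) {ε : ℝ} (hε : 0 < ε) :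
    ‖a + b‖ ^ 2 ≤ (1 + ε) * ‖a‖ ^ 2 + (1 + 1 / ε) * ‖b‖ ^ 2 := by
  have h1 : ‖a + b‖ ^ 2 ≤ (‖a‖ + ‖b‖) ^ 2 := by gcongr; exact norm_add_le a b
  have h2 : (1 + ε) * ‖a‖ ^ 2 + (1 + 1 / ε) * ‖b‖ ^ 2 - (‖a‖ + ‖b‖) ^ 2 =
      (ε * ‖a‖ - ‖b‖) ^ 2 / ε := by
    field_simp; ring
  have h3 : 0 ≤ (ε * ‖a‖ - ‖b‖) ^ 2 / ε := by positivity
  linarith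

lemma energy_add_le {ρ : ℝ} (hρ : 0 < ρ) (S T : H →L[ℝ] F) (q β e b : H) {ε : ℝ}
    (hε : 0 < ε) :
    energy ρ S T (q + e) (β + b) ≤
      (1 + ε) * energy ρ S T q β + (1 + 1 / ε) * energy ρ S T e b := by
  have h1 := mul_le_mul_of_nonneg_left (norm_add_sq_le_weighted (T q) (T e) hε)
    (by positivity : 0 ≤ ρ / 2)
  have h2 := mul_le_mul_of_nonneg_left (norm_add_sq_le_weighted (S β) (S b) hε)
    (by positivity : 0 ≤ 1 / (2 * ρ))
  unfold energy
  rw [map_add, map_add]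
  linarith

lemma energy_smul_self_le {ρ : ℝ} (hρ : 0 < ρ) (S T : H →L[ℝ] F) (e : H) :
    energy ρ S T e (ρ • e) ≤ ρ / 2 * (‖T‖ ^ 2 + ‖S‖ ^ 2) * ‖e‖ ^ 2 := by
  have h1 : ‖T e‖ ^ 2 ≤ (‖T‖ * ‖e‖) ^ 2 := by gcongr; exact T.le_opNorm e
  have h2 : ‖S e‖ ^ 2 ≤ (‖S‖ * ‖e‖) ^ 2 := by gcongr; exact S.le_opNorm e
  have h3 : energy ρ S T e (ρ • e) = ρ / 2 * (‖T e‖ ^ 2 + ‖S e‖ ^ 2) := by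
    unfold energy
    rw [map_smul, norm_smul, mul_pow, Real.norm_eq_abs, sq_abs]
    field_simp
  rw [h3, mul_assoc]
  gcongr
  nlinarith

/-- A linear map on a finite-dimensional space has bounded preimages on its range. -/
lemma exists_preimage_norm_le [FiniteDimensional ℝ H] (S : H →L[ℝ] F) :
    ∃ C : ℝ, 0 ≤ C ∧ ∀ β : H, ∃ h : H, S h = S β ∧ ‖h‖ ≤ C * ‖S β‖ := by
  obtain ⟨g, hg⟩ := (S : H →ₗ[ℝ] F).rangeRestrict.exists_rightInverse_of_surjective
    (LinearMap.range_rangeRestrict _)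
  refine ⟨‖g.toContinuousLinearMap‖, by positivity, fun β => ?_⟩
  let z := (S : H →ₗ[ℝ] F).rangeRestrict β
  refine ⟨g z, ?_, ?_⟩
  · have := LinearMap.congr_fun hg z
    exact congrArg Subtype.val this
  · exact g.toContinuousLinearMap.le_opNorm z

/-- The update determines the energy: testing the equation against a bounded preimage of `S β`
controls `‖S β‖` by the three other vectors of the equation. -/
lemma exists_energy_le [FiniteDimensional ℝ H] {ρ : ℝ} (hρ : 0 < ρ) (S T : H →L[ℝ] F) :
    ∃ K : ℝ, 1 ≤ K ∧ ∀ f x' q β : H, WeakUpdate ρ S T f x' q β →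
      energy ρ S T q β ≤ K * (‖x'‖ ^ 2 + ‖q‖ ^ 2 + ‖f‖ ^ 2) := by
  obtain ⟨C, hC, hpre⟩ := exists_preimage_norm_le S
  set D : ℝ := 1 + ρ / 2 * (‖S‖ ^ 2 + ‖T‖ ^ 2) with hD
  have hD0 : 0 ≤ D := by positivity
  refine ⟨1 + ρ / 2 * ‖T‖ ^ 2 + 1 / (2 * ρ) * (2 * D * C) ^ 2 * 3, ?_, ?_⟩
  · have : 0 ≤ ρ / 2 * ‖T‖ ^ 2 + 1 / (2 * ρ) * (2 * D * C) ^ 2 * 3 := by positivity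
    linarith
  intro f x' q β hx
  obtain ⟨h, hSh, hh⟩ := hpre β
  have key := hx h
  rw [hSh, real_inner_self_eq_norm_sq] at key
  have hSx : ‖S x'‖ ≤ ‖S‖ * ‖x'‖ := S.le_opNorm _
  have hSβ : ‖S β‖ ≤ ‖S‖ * ‖h‖ := hSh ▸ S.le_opNorm h
  have hTx : ‖T x'‖ ≤ ‖T‖ * ‖x'‖ := T.le_opNorm _
  have hTq : ‖T q‖ ≤ ‖T‖ * ‖q‖ := T.le_opNorm _
  have hTh : ‖T h‖ ≤ ‖T‖ * ‖h‖ := T.le_opNorm _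
  have i1 : -inner ℝ x' h ≤ ‖x'‖ * ‖h‖ :=
    (neg_le_abs _).trans (abs_real_inner_le_norm _ _)
  have i2 : -inner ℝ (S x') (S β) ≤ ‖S‖ ^ 2 * (‖x'‖ * ‖h‖) :=
    (neg_le_abs _).trans ((abs_real_inner_le_norm _ _).trans
      ((mul_le_mul hSx hSβ (norm_nonneg _) (by positivity)).trans_eq (by ring)))
  have i3 : -inner ℝ (T x') (T h) ≤ ‖T‖ ^ 2 * (‖x'‖ * ‖h‖) :=
    (neg_le_abs _).trans ((abs_real_inner_le_norm _ _).trans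
      ((mul_le_mul hTx hTh (norm_nonneg _) (by positivity)).trans_eq (by ring)))
  have i4 : inner ℝ (T q) (T h) ≤ ‖T‖ ^ 2 * (‖q‖ * ‖h‖) :=
    (real_inner_le_norm _ _).trans
      ((mul_le_mul hTq hTh (norm_nonneg _) (by positivity)).trans_eq (by ring))
  have i5 : inner ℝ f h ≤ ‖f‖ * ‖h‖ := real_inner_le_norm _ _
  have e1 : ‖S β‖ ^ 2 ≤ 2 * D * (‖x'‖ + ‖q‖ + ‖f‖) * ‖h‖ := by
    have j1 : 0 ≤ ρ / 2 * ‖S‖ ^ 2 * (‖q‖ * ‖h‖) := by positivity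
    have j2 : 0 ≤ ρ / 2 * ‖S‖ ^ 2 * (‖f‖ * ‖h‖) := by positivity
    have j3 : 0 ≤ ρ / 2 * ‖T‖ ^ 2 * (‖f‖ * ‖h‖) := by positivity
    have j4 : 0 ≤ ‖q‖ * ‖h‖ := by positivity
    have i2' := mul_le_mul_of_nonneg_left i2 (by positivity : 0 ≤ ρ / 2)
    have i3' := mul_le_mul_of_nonneg_left i3 (by positivity : 0 ≤ ρ / 2)
    have i4' := mul_le_mul_of_nonneg_left i4 (by positivity : 0 ≤ ρ / 2)
    rw [hD]
    linarith
  have e2 : ‖S β‖ ≤ 2 * D * C * (‖x'‖ + ‖q‖ + ‖f‖) := by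
    rcases (norm_nonneg (S β)).eq_or_lt with h0 | h0
    · rw [← h0]; positivity
    · refine le_of_mul_le_mul_right ?_ h0
      calc ‖S β‖ * ‖S β‖ = ‖S β‖ ^ 2 := by ring
        _ ≤ 2 * D * (‖x'‖ + ‖q‖ + ‖f‖) * ‖h‖ := e1
        _ ≤ 2 * D * (‖x'‖ + ‖q‖ + ‖f‖) * (C * ‖S β‖) := by gcongr
        _ = _ := by ring
  have e3 : ‖S β‖ ^ 2 ≤ (2 * D * C) ^ 2 * 3 * (‖x'‖ ^ 2 + ‖q‖ ^ 2 + ‖f‖ ^ 2) := by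
    calc ‖S β‖ ^ 2 ≤ (2 * D * C * (‖x'‖ + ‖q‖ + ‖f‖)) ^ 2 := by gcongr
      _ = (2 * D * C) ^ 2 * (‖x'‖ + ‖q‖ + ‖f‖) ^ 2 := by ring
      _ ≤ (2 * D * C) ^ 2 * (3 * (‖x'‖ ^ 2 + ‖q‖ ^ 2 + ‖f‖ ^ 2)) := by
        gcongr
        nlinarith [sq_nonneg (‖x'‖ - ‖q‖), sq_nonneg (‖x'‖ - ‖f‖), sq_nonneg (‖q‖ - ‖f‖)]
      _ = _ := by ring
  have e4 : ‖T q‖ ^ 2 ≤ ‖T‖ ^ 2 * (‖x'‖ ^ 2 + ‖q‖ ^ 2 + ‖f‖ ^ 2) := by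
    calc ‖T q‖ ^ 2 ≤ (‖T‖ * ‖q‖) ^ 2 := by gcongr
      _ = ‖T‖ ^ 2 * ‖q‖ ^ 2 := by ring
      _ ≤ _ := by gcongr; nlinarith [sq_nonneg ‖x'‖, sq_nonneg ‖f‖]
  have e3' := mul_le_mul_of_nonneg_left e3 (by positivity : 0 ≤ 1 / (2 * ρ))
  have e4' := mul_le_mul_of_nonneg_left e4 (by positivity : 0 ≤ ρ / 2)
  unfold energy
  have : 0 ≤ ‖x'‖ ^ 2 + ‖q‖ ^ 2 + ‖f‖ ^ 2 := by positivity
  linarith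

/-- A discrete stability criterion: `W` grows by at most a factor close to `1` and dissipates `a`,
while the dissipation of two consecutive steps controls `W`. If `W` exceeded the bound at time
`k + 2`, the dissipation up to then would be small, hence so would `W (k + 1)` be, and with it
`W (k + 2)`. -/
lemma bounded_of_dissipation {W a : ℕ → ℝ} {K A B w₀ : ℝ} (hK : 1 ≤ K) (hB : 0 ≤ B)
    (hAB : A ≤ B) (hw₀ : 0 ≤ w₀) (ha : ∀ k, 0 ≤ a k) (hW₀ : W 0 ≤ w₀)
    (hstep : ∀ k, W (k + 1) ≤ (1 + 1 / (12 * K)) * W k - a (k + 1) + B)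
    (hdiss : ∀ k, W (k + 1) ≤ K * (a (k + 2) + a (k + 1) + A)) (k : ℕ) :
    W k ≤ 2 * w₀ + B + 20 * K * B := by
  have hK0 : 0 < K := by linarith
  set ε := 1 / (12 * K) with hε
  have hε0 : 0 < ε := by positivity
  have hεK : ε * K = 1 / 12 := by rw [hε]; field_simp
  have hε1 : ε ≤ 1 / 12 := by nlinarith
  set M := 2 * w₀ + B + 20 * K * B with hM
  have hM0 : 0 ≤ M := by positivity
  induction k using Nat.twoStepInduction with
  | zero => nlinarith [mul_nonneg hK0.le hB]
  | one =>
    have := hstep 0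
    have := ha 1
    simp only [zero_add] at *
    nlinarith [mul_nonneg hK0.le hB]
  | more n ih0 _ =>
    have s1 := hstep n
    have s2 : W (n + 1 + 1) ≤ (1 + ε) * W (n + 1) - a (n + 2) + B := hstep (n + 1)
    have d := hdiss n
    have a1 := ha (n + 1)
    have a2 := ha (n + 2)
    have e1 := mul_le_mul_of_nonneg_left s1 (by linarith : 0 ≤ 1 + ε)
    have t1 : (1 + ε) * ((1 + ε) * W n) ≤ (1 + 3 * ε) * M := by
      have : (1 + ε) * ((1 + ε) * W n) ≤ (1 + ε) * ((1 + ε) * M) := by gcongr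
      nlinarith
    have t2 : W (n + 1 + 1) + a (n + 1) + a (n + 2) ≤ (1 + 3 * ε) * M + 3 * B := by
      have u1 := mul_nonneg hε0.le a1
      have u2 := mul_nonneg (sub_nonneg.2 hε1) hB
      linarith
    by_contra hcon
    push Not at hcon
    have hc : M < W (n + 1 + 1) := hcon
    have t3 : a (n + 1) + a (n + 2) ≤ 3 * ε * M + 3 * B := by linarith
    have t4 : W (n + 1) ≤ M / 4 + 4 * K * B := by
      have : K * (a (n + 2) + a (n + 1) + A) ≤ K * (3 * ε * M + 3 * B + B) := by
        refine mul_le_mul_of_nonneg_left ?_ hK0.le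
        linarith
      have h2 : K * (3 * ε * M + 3 * B + B) = 3 * (ε * K) * M + 4 * K * B := by ring
      rw [h2, hεK] at this
      linarith
    have hKB := mul_nonneg hK0.le hB
    have hKB' : B ≤ K * B := by nlinarith
    have t5 : (1 + ε) * W (n + 1) ≤ (1 + ε) * (M / 4 + 4 * K * B) := by gcongr
    have t6 : (1 + ε) * (M / 4 + 4 * K * B) ≤ (1 + 1 / 12) * (M / 4 + 4 * K * B) := by
      gcongr
    linarith

/-- Runs of the recursion with quantization errors of norm at most `δ` are bounded, with a bound
that depends only on the initial value and the forcing. -/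
theorem exists_bound_of_weakUpdate [FiniteDimensional ℝ H] {ρ : ℝ} (hρ : 0 < ρ)
    (S T : H →L[ℝ] F) (δ : ℝ) (f x₀ : H) :
    ∃ R : ℝ, ∀ x q β : ℕ → H, x 0 = x₀ → β 0 = 0 → (∀ k, ‖q k - x k‖ ≤ δ) →
      (∀ k, WeakUpdate ρ S T f (x (k + 1)) (q k) (β k)) →
      (∀ k, β (k + 1) = β k + ρ • q (k + 1)) → ∀ k, ‖x k‖ ≤ R ∧ ‖S (β k)‖ ≤ R := by
  obtain ⟨K', hK', hdiss⟩ := exists_energy_le hρ S T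
  -- the factor `3` absorbs the loss in passing from `‖q‖²` to `‖x‖²`
  set K := 3 * K' with hK
  set ε : ℝ := 1 / (12 * K) with hε
  have hε0 : 0 < ε := by rw [hε]; positivity
  have hε1 : ε ≤ 1 := by
    rw [hε, div_le_one (by positivity)]; linarith
  set w₀ := ρ / 2 * (‖T‖ * (‖x₀‖ + δ)) ^ 2 with hw₀
  set A := 2 * δ ^ 2 + ‖f‖ ^ 2 with hA
  set N := ρ / 2 * (‖T‖ ^ 2 + ‖S‖ ^ 2) * δ ^ 2 with hN
  set B := A + (1 + ε) * ‖f‖ ^ 2 + (1 + 1 / ε) * N with hB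
  have hN0 : 0 ≤ N := by positivity
  have hA0 : 0 ≤ A := by positivity
  have hAB : A ≤ B := by
    have : 0 ≤ (1 + ε) * ‖f‖ ^ 2 + (1 + 1 / ε) * N := by positivity
    linarith
  have hB0 : 0 ≤ B := hA0.trans hAB
  set M := 2 * w₀ + B + 20 * K * B with hM
  have hM0 : 0 ≤ M := by positivity
  refine ⟨‖x₀‖ + √(M + ‖f‖ ^ 2) + √(2 * ρ * M), ?_⟩
  intro x q β hx0 hβ0 hq hx hβ
  have hq2 : ∀ k, ‖q k‖ ^ 2 ≤ 2 * ‖x k‖ ^ 2 + 2 * δ ^ 2 := by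
    intro k
    have h1 : ‖q k‖ ≤ ‖x k‖ + δ := by
      calc ‖q k‖ = ‖x k + (q k - x k)‖ := by rw [add_sub_cancel]
        _ ≤ _ := (norm_add_le _ _).trans (by gcongr; exact hq k)
    have h2 : ‖q k‖ ^ 2 ≤ (‖x k‖ + δ) ^ 2 := by gcongr
    nlinarith [sq_nonneg (‖x k‖ - δ)]
  have hW : ∀ k, energy ρ S T (q k) (β k) ≤ M := by
    refine bounded_of_dissipation (W := fun k => energy ρ S T (q k) (β k))
      (a := fun k => ‖x k‖ ^ 2) (A := A) (by linarith) hB0 hAB (by positivity)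
      (fun k => by positivity) ?_ ?_ ?_
    · have h1 : ‖q 0‖ ≤ ‖x₀‖ + δ := by
        calc ‖q 0‖ = ‖x 0 + (q 0 - x 0)‖ := by rw [add_sub_cancel]
          _ ≤ _ := (norm_add_le _ _).trans (by rw [hx0]; gcongr; rw [← hx0]; exact hq 0)
      have h2 : ‖T (q 0)‖ ≤ ‖T‖ * (‖x₀‖ + δ) := T.le_of_opNorm_le_of_le le_rfl h1
      simp only [energy, hβ0, map_zero, norm_zero]
      rw [hw₀]
      have : ‖T (q 0)‖ ^ 2 ≤ (‖T‖ * (‖x₀‖ + δ)) ^ 2 := by gcongr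
      nlinarith
    · intro k
      have e1 := energy_update_le hρ (hx k)
      have e2 := energy_add_le hρ S T (x (k + 1)) (β k + ρ • x (k + 1))
        (q (k + 1) - x (k + 1)) (ρ • (q (k + 1) - x (k + 1))) hε0
      have e3 : energy ρ S T (q (k + 1) - x (k + 1)) (ρ • (q (k + 1) - x (k + 1))) ≤ N := by
        refine (energy_smul_self_le hρ S T _).trans ?_
        rw [hN]; gcongr; exact hq _
      have e4 : β k + ρ • x (k + 1) + ρ • (q (k + 1) - x (k + 1)) = β (k + 1) := by
        rw [hβ, smul_sub]; abel
      rw [add_sub_cancel, e4] at e2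
      have e5 := mul_le_mul_of_nonneg_left e1 (by linarith : 0 ≤ 1 + ε)
      have e6 := mul_le_mul_of_nonneg_left e3 (by positivity : 0 ≤ 1 + 1 / ε)
      have e7 : 0 ≤ ε * ‖x (k + 1)‖ ^ 2 := by positivity
      change energy ρ S T (q (k + 1)) (β (k + 1)) ≤
        (1 + ε) * energy ρ S T (q k) (β k) - ‖x (k + 1)‖ ^ 2 + B
      linarith
    · intro k
      refine (hdiss _ _ _ _ (hx (k + 1))).trans ?_
      change _ ≤ 3 * K' * (‖x (k + 2)‖ ^ 2 + ‖x (k + 1)‖ ^ 2 + A)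
      rw [mul_comm 3 K', mul_assoc]
      have := hq2 (k + 1)
      have h1 : 0 ≤ ‖x (k + 2)‖ ^ 2 := by positivity
      have h2 : 0 ≤ ‖x (k + 1)‖ ^ 2 := by positivity
      have h3 : 0 ≤ ‖f‖ ^ 2 := by positivity
      have h4 : 0 ≤ δ ^ 2 := by positivity
      change K' * (‖x (k + 2)‖ ^ 2 + ‖q (k + 1)‖ ^ 2 + ‖f‖ ^ 2) ≤ _
      gcongr
      linarith
  intro k
  have r1 : 0 ≤ √(M + ‖f‖ ^ 2) := Real.sqrt_nonneg _
  have r2 : 0 ≤ √(2 * ρ * M) := Real.sqrt_nonneg _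
  have r3 : 0 ≤ ‖x₀‖ := norm_nonneg _
  constructor
  · cases k with
    | zero => rw [hx0]; linarith
    | succ k =>
      have e1 := energy_update_le hρ (hx k)
      have e2 := energy_nonneg hρ S T (x (k + 1)) (β k + ρ • x (k + 1))
      have : ‖x (k + 1)‖ ≤ √(M + ‖f‖ ^ 2) := by
        apply Real.le_sqrt_of_sq_le
        linarith [hW k]
      linarith
  · have h1 : ‖S (β k)‖ ≤ √(2 * ρ * M) := by
      apply Real.le_sqrt_of_sq_le
      have h2 := hW k
      unfold energy at h2
      have h3 : 0 ≤ ρ / 2 * ‖T (q k)‖ ^ 2 := by positivity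
      have h4 : 1 / (2 * ρ) * ‖S (β k)‖ ^ 2 ≤ M := by linarith
      calc ‖S (β k)‖ ^ 2 = 2 * ρ * (1 / (2 * ρ) * ‖S (β k)‖ ^ 2) := by field_simp
        _ ≤ _ := by gcongr
    linarith

end Energy

/-! ### Strong law for bounded martingale differences -/

section StrongLaw

variable {Ω : Type*} {m₀ : MeasurableSpace Ω} {P : Measure Ω}

lemma integral_mul_eq_zero_of_condExp [IsFiniteMeasure P] {m : MeasurableSpace Ω}
    (hm : m ≤ m₀) {f e : Ω → ℝ}
    (hf : StronglyMeasurable[m] f) (hfe : Integrable (f * e) P) (he : Integrable e P)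
    (h0 : P[e | m] =ᵐ[P] 0) : ∫ ω, f ω * e ω ∂P = 0 := by
  have h1 := condExp_mul_of_stronglyMeasurable_left hf hfe he
  have h2 : P[f * e | m] =ᵐ[P] 0 := by
    filter_upwards [h1, h0] with ω h1 h0
    rw [h1, Pi.mul_apply, h0, Pi.zero_apply, mul_zero]
  change ∫ ω, (f * e) ω ∂P = 0
  rw [← integral_condExp hm, integral_congr_ae h2]
  simp

variable {ℱ : Filtration ℕ m₀} {e : ℕ → Ω → ℝ} {c : ℝ}

lemma measurable_sum_range (hmeas : ∀ k, Measurable[ℱ (k + 1)] (e k)) (n : ℕ) :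
    Measurable[ℱ n] fun ω => ∑ k ∈ Finset.range n, e k ω :=
  Finset.measurable_sum _ fun k hk =>
    (hmeas k).mono (ℱ.mono (Finset.mem_range.1 hk)) le_rfl

lemma ae_abs_sum_range_le (hbdd : ∀ k, ∀ᵐ ω ∂P, |e k ω| ≤ c) :
    ∀ᵐ ω ∂P, ∀ n : ℕ, |∑ k ∈ Finset.range n, e k ω| ≤ n * c := by
  filter_upwards [ae_all_iff.2 hbdd] with ω h n
  calc |∑ k ∈ Finset.range n, e k ω| ≤ ∑ k ∈ Finset.range n, |e k ω| :=
        Finset.abs_sum_le_sum_abs _ _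
    _ ≤ ∑ _k ∈ Finset.range n, c := Finset.sum_le_sum fun k _ => h k
    _ = n * c := by simp

lemma integrable_sum_pow_mul_pow [IsFiniteMeasure P] (hmeas : ∀ k, Measurable[ℱ (k + 1)] (e k))
    (hbdd : ∀ k, ∀ᵐ ω ∂P, |e k ω| ≤ c) (n a b : ℕ) :
    Integrable (fun ω => (∑ k ∈ Finset.range n, e k ω) ^ a * e n ω ^ b) P := by
  refine Integrable.of_bound (C := (n * c) ^ a * c ^ b) ?_ ?_
  · exact ((((measurable_sum_range hmeas n).mono (ℱ.le n) le_rfl).pow_const a).mul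
      (((hmeas n).mono (ℱ.le _) le_rfl).pow_const b)).aestronglyMeasurable
  · filter_upwards [ae_abs_sum_range_le hbdd, hbdd n] with ω h1 h2
    have hc : 0 ≤ c := (abs_nonneg _).trans h2
    rw [norm_mul, norm_pow, norm_pow, Real.norm_eq_abs, Real.norm_eq_abs]
    have := h1 n
    gcongr

lemma integral_sum_pow_mul_eq_zero [IsFiniteMeasure P] (hmeas : ∀ k, Measurable[ℱ (k + 1)] (e k))
    (hbdd : ∀ k, ∀ᵐ ω ∂P, |e k ω| ≤ c) (hmart : ∀ k, P[e k | ℱ k] =ᵐ[P] 0) (n a : ℕ) :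
    ∫ ω, (∑ k ∈ Finset.range n, e k ω) ^ a * e n ω ^ 1 ∂P = 0 := by
  have h1 := integrable_sum_pow_mul_pow hmeas hbdd n a 1
  have h2 := integrable_sum_pow_mul_pow hmeas hbdd n 0 1
  simp only [pow_zero, one_mul, pow_one] at h1 h2 ⊢
  exact integral_mul_eq_zero_of_condExp (ℱ.le n)
    ((measurable_sum_range hmeas n).pow_const a).stronglyMeasurable h1 h2 (hmart n)

lemma integral_sum_sq_le [IsProbabilityMeasure P] (hmeas : ∀ k, Measurable[ℱ (k + 1)] (e k))
    (hbdd : ∀ k, ∀ᵐ ω ∂P, |e k ω| ≤ c) (hmart : ∀ k, P[e k | ℱ k] =ᵐ[P] 0) (n : ℕ) :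
    ∫ ω, (∑ k ∈ Finset.range n, e k ω) ^ 2 ∂P ≤ n * c ^ 2 := by
  induction n with
  | zero => simp
  | succ n ih =>
    have i20 := integrable_sum_pow_mul_pow hmeas hbdd n 2 0
    have i11 := integrable_sum_pow_mul_pow hmeas hbdd n 1 1
    have z := integral_sum_pow_mul_eq_zero hmeas hbdd hmart n 1
    have j1 : Integrable (fun ω => (∑ k ∈ Finset.range n, e k ω) ^ 2 * e n ω ^ 0 +
        2 * ((∑ k ∈ Finset.range n, e k ω) ^ 1 * e n ω ^ 1)) P := i20.add (i11.const_mul 2)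
    have hle : ∫ ω, (∑ k ∈ Finset.range (n + 1), e k ω) ^ 2 ∂P ≤
        ∫ ω, ((∑ k ∈ Finset.range n, e k ω) ^ 2 * e n ω ^ 0 +
          2 * ((∑ k ∈ Finset.range n, e k ω) ^ 1 * e n ω ^ 1) + c ^ 2) ∂P := by
      refine integral_mono_ae ?_ (j1.add (integrable_const _)) ?_
      · simpa using integrable_sum_pow_mul_pow hmeas hbdd (n + 1) 2 0
      · filter_upwards [hbdd n] with ω h
        have := sq_le_sq' (abs_le.1 h).1 (abs_le.1 h).2
        simp only [Finset.sum_range_succ]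
        nlinarith
    rw [integral_add j1 (integrable_const _),
      integral_add i20 (i11.const_mul 2), integral_const_mul, z] at hle
    simp only [pow_zero, mul_one, integral_const, probReal_univ, one_smul] at hle
    push_cast
    linarith

/-- The fourth moment of a martingale with bounded increments grows quadratically: the odd cross
term `4 S³ e` has mean zero. -/
lemma integral_sum_pow_four_le [IsProbabilityMeasure P] (hmeas : ∀ k, Measurable[ℱ (k + 1)] (e k))
    (hbdd : ∀ k, ∀ᵐ ω ∂P, |e k ω| ≤ c) (hmart : ∀ k, P[e k | ℱ k] =ᵐ[P] 0) (n : ℕ) :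
    ∫ ω, (∑ k ∈ Finset.range n, e k ω) ^ 4 ∂P ≤ 4 * n ^ 2 * c ^ 4 := by
  induction n with
  | zero => simp
  | succ n ih =>
    have i40 := integrable_sum_pow_mul_pow hmeas hbdd n 4 0
    have i31 := integrable_sum_pow_mul_pow hmeas hbdd n 3 1
    have i20 := integrable_sum_pow_mul_pow hmeas hbdd n 2 0
    have z := integral_sum_pow_mul_eq_zero hmeas hbdd hmart n 3
    have j1 : Integrable (fun ω => (∑ k ∈ Finset.range n, e k ω) ^ 4 * e n ω ^ 0 +
        4 * ((∑ k ∈ Finset.range n, e k ω) ^ 3 * e n ω ^ 1)) P := i40.add (i31.const_mul 4)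
    have j2 : Integrable (fun ω => (∑ k ∈ Finset.range n, e k ω) ^ 4 * e n ω ^ 0 +
        4 * ((∑ k ∈ Finset.range n, e k ω) ^ 3 * e n ω ^ 1) +
        8 * c ^ 2 * ((∑ k ∈ Finset.range n, e k ω) ^ 2 * e n ω ^ 0)) P :=
      j1.add (i20.const_mul (8 * c ^ 2))
    have hsq := integral_sum_sq_le hmeas hbdd hmart n
    have hle : ∫ ω, (∑ k ∈ Finset.range (n + 1), e k ω) ^ 4 ∂P ≤
        ∫ ω, ((∑ k ∈ Finset.range n, e k ω) ^ 4 * e n ω ^ 0 +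
          4 * ((∑ k ∈ Finset.range n, e k ω) ^ 3 * e n ω ^ 1) +
          8 * c ^ 2 * ((∑ k ∈ Finset.range n, e k ω) ^ 2 * e n ω ^ 0) + 3 * c ^ 4) ∂P := by
      refine integral_mono_ae ?_ (j2.add (integrable_const _)) ?_
      · simpa using integrable_sum_pow_mul_pow hmeas hbdd (n + 1) 4 0
      · filter_upwards [hbdd n] with ω h
        have h2 : e n ω ^ 2 ≤ c ^ 2 := sq_le_sq' (abs_le.1 h).1 (abs_le.1 h).2
        simp only [Finset.sum_range_succ]
        generalize ∑ k ∈ Finset.range n, e k ω = s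
        generalize e n ω = d at h2
        -- `4 s d³ ≤ 2 s² d² + 2 d⁴`, and `d² ≤ c²` in the terms of even degree
        have h3 : 4 * s * d ^ 3 ≤ 2 * s ^ 2 * d ^ 2 + 2 * d ^ 4 := by
          nlinarith [sq_nonneg (s * d - d ^ 2)]
        have h4 : s ^ 2 * d ^ 2 ≤ s ^ 2 * c ^ 2 := by gcongr
        have h5 : d ^ 4 ≤ c ^ 4 := by
          calc d ^ 4 = (d ^ 2) ^ 2 := by ring
            _ ≤ (c ^ 2) ^ 2 := by gcongr
            _ = c ^ 4 := by ring
        have h6 : (s + d) ^ 4 = s ^ 4 + 4 * (s ^ 3 * d) + 6 * (s ^ 2 * d ^ 2) +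
          4 * s * d ^ 3 + d ^ 4 := by ring
        rw [h6]
        simp only [pow_zero, pow_one, mul_one]
        linarith
    rw [integral_add j2 (integrable_const _), integral_add j1 (i20.const_mul (8 * c ^ 2)),
      integral_add i40 (i31.const_mul 4), integral_const_mul, integral_const_mul, z] at hle
    simp only [pow_zero, mul_one, integral_const, probReal_univ, one_smul] at hle
    have h7 : 8 * c ^ 2 * ∫ ω, (∑ k ∈ Finset.range n, e k ω) ^ 2 ∂P ≤
        8 * c ^ 2 * (n * c ^ 2) := by gcongr
    have h8 : 0 ≤ c ^ 4 := by positivity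
    push_cast
    nlinarith

/-- The strong law of large numbers for bounded martingale differences: by the fourth moment bound,
the fourth powers of the averages have summable expectations. -/
theorem ae_tendsto_average_zero_of_martingaleDifference [IsProbabilityMeasure P]
    (hmeas : ∀ k, Measurable[ℱ (k + 1)] (e k))
    (hbdd : ∀ k, ∀ᵐ ω ∂P, |e k ω| ≤ c) (hmart : ∀ k, P[e k | ℱ k] =ᵐ[P] 0) :
    ∀ᵐ ω ∂P, Tendsto (fun n : ℕ => (∑ k ∈ Finset.range n, e k ω) / n) atTop (𝓝 0) := by
  set Y : ℕ → Ω → ℝ := fun n ω => ((∑ k ∈ Finset.range n, e k ω) / n) ^ 4 with hY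
  have hYm : ∀ n, Measurable (Y n) := fun n =>
    (((measurable_sum_range hmeas n).mono (ℱ.le n) le_rfl).div_const _).pow_const 4
  have hY0 : ∀ n ω, 0 ≤ Y n ω := fun n ω => by simp only [hY]; positivity
  have hYi : ∀ n, Integrable (Y n) P := fun n => by
    have := (integrable_sum_pow_mul_pow hmeas hbdd n 4 0).div_const ((n : ℝ) ^ 4)
    simpa only [hY, pow_zero, mul_one, div_pow] using this
  have hYle : ∀ n : ℕ, ∫ ω, Y n ω ∂P ≤ 4 * c ^ 4 * (1 / (n : ℝ) ^ 2) := fun n => by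
    rcases Nat.eq_zero_or_pos n with rfl | hn
    · simp [hY]
    · have hn' : (0 : ℝ) < n := by exact_mod_cast hn
      simp only [hY, div_pow]
      rw [integral_div, div_le_iff₀ (by positivity)]
      refine (integral_sum_pow_four_le hmeas hbdd hmart n).trans_eq ?_
      field_simp
  have hsum : Summable fun n : ℕ => 4 * c ^ 4 * (1 / (n : ℝ) ^ 2) :=
    (Real.summable_one_div_nat_pow.2 one_lt_two).mul_left _
  have hfin : ∫⁻ ω, ∑' n, ENNReal.ofReal (Y n ω) ∂P ≠ ⊤ := by
    rw [lintegral_tsum fun n => ((hYm n).ennreal_ofReal).aemeasurable]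
    refine ne_top_of_le_ne_top hsum.tsum_ofReal_ne_top (ENNReal.tsum_le_tsum fun n => ?_)
    rw [← ofReal_integral_eq_lintegral_ofReal (hYi n) (ae_of_all _ (hY0 n))]
    exact ENNReal.ofReal_le_ofReal (hYle n)
  filter_upwards [ae_lt_top' (AEMeasurable.tsum
    fun n => ((hYm n).ennreal_ofReal).aemeasurable) hfin] with ω hω
  have h1 := ENNReal.tendsto_atTop_zero_of_tsum_ne_top hω.ne
  have h2 : Tendsto (fun n => Y n ω) atTop (𝓝 0) := by
    have := (ENNReal.tendsto_toReal ENNReal.zero_ne_top).comp h1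
    simpa [Function.comp_def, ENNReal.toReal_ofReal (hY0 _ ω)] using this
  rw [tendsto_zero_iff_abs_tendsto_zero]
  have h3 := h2.rpow_const (p := ((4 : ℕ) : ℝ)⁻¹) (Or.inr (by norm_num))
  rw [Real.zero_rpow (by norm_num)] at h3
  refine h3.congr fun n => ?_
  simp only [hY, Function.comp_apply]
  rw [← Even.pow_abs (by decide : Even 4), Real.pow_rpow_inv_natCast (abs_nonneg _) (by norm_num)]

end StrongLaw

/-! ### The probabilistic quantizer -/

section Quantizer

lemma quantLaw_real_apply (Δ y : ℝ) {B : Set ℝ} (hB : MeasurableSet B) :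
    (quantLaw Δ y).real B =
      (⌊y / Δ⌋ + 1 - y / Δ) * B.indicator 1 (⌊y / Δ⌋ * Δ) +
        (y / Δ - ⌊y / Δ⌋) * B.indicator 1 ((⌊y / Δ⌋ + 1) * Δ) := by
  have h1 : 0 ≤ (⌊y / Δ⌋ : ℝ) + 1 - y / Δ := by linarith [Int.lt_floor_add_one (y / Δ)]
  have h2 : 0 ≤ y / Δ - (⌊y / Δ⌋ : ℝ) := by linarith [Int.floor_le (y / Δ)]
  have hfin : ∀ a b : ℝ, (ENNReal.ofReal a • Measure.dirac b) B ≠ ⊤ := fun a b => by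
    rw [Measure.smul_apply, smul_eq_mul]
    exact ENNReal.mul_ne_top ENNReal.ofReal_ne_top (measure_ne_top _ _)
  rw [quantLaw, measureReal_add_apply (hfin _ _) (hfin _ _), measureReal_ennreal_smul_apply,
    measureReal_ennreal_smul_apply, ENNReal.toReal_ofReal h1, ENNReal.toReal_ofReal h2]
  simp only [measureReal_def, Measure.dirac_apply' _ hB]
  congr 2 <;> (unfold Set.indicator; split_ifs <;> simp)

lemma quantLaw_real_eq_zero {Δ : ℝ} (hΔ : 0 < Δ) (y : ℝ) {B : Set ℝ} (hB : MeasurableSet B)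
    (h : ∀ t : ℤ, |t * Δ - y| ≤ Δ → t * Δ ∉ B) : (quantLaw Δ y).real B = 0 := by
  have h1 : ⌊y / Δ⌋ * Δ ≤ y := (le_div_iff₀ hΔ).1 (Int.floor_le _)
  have h2 : y < (⌊y / Δ⌋ + 1) * Δ := (div_lt_iff₀ hΔ).1 (Int.lt_floor_add_one _)
  have h3 := h ⌊y / Δ⌋ (by rw [abs_le]; constructor <;> linarith)
  have h4 := h (⌊y / Δ⌋ + 1) (by push_cast; rw [abs_le]; constructor <;> linarith)
  push_cast at h4
  rw [quantLaw_real_apply Δ y hB, Set.indicator_of_notMem h3, Set.indicator_of_notMem h4]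
  simp

/-- The quantizer is unbiased; the finite set `s` need only hold the two levels around `y`. -/
lemma sum_mul_quantLaw_real_singleton {Δ : ℝ} (hΔ : 0 < Δ) (y : ℝ) {s : Finset ℤ}
    (h1 : ⌊y / Δ⌋ ∈ s) (h2 : ⌊y / Δ⌋ + 1 ∈ s) :
    ∑ t ∈ s, (t * Δ : ℝ) * (quantLaw Δ y).real {(t * Δ : ℝ)} = y := by
  have h3 : ∀ t : ℤ, ({(t * Δ : ℝ)} : Set ℝ).indicator (1 : ℝ → ℝ) (⌊y / Δ⌋ * Δ) =
      if ⌊y / Δ⌋ = t then 1 else 0 := by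
    intro t
    simp [Set.indicator_apply, hΔ.ne']
  have h4 : ∀ t : ℤ, ({(t * Δ : ℝ)} : Set ℝ).indicator (1 : ℝ → ℝ) ((⌊y / Δ⌋ + 1) * Δ) =
      if ⌊y / Δ⌋ + 1 = t then 1 else 0 := by
    intro t
    have : ((⌊y / Δ⌋ : ℝ) + 1 = t) ↔ ⌊y / Δ⌋ + 1 = t := by norm_cast
    simp [Set.indicator_apply, hΔ.ne', this]
  simp_rw [quantLaw_real_apply Δ y (measurableSet_singleton _), h3, h4, mul_add,
    Finset.sum_add_distrib, mul_ite, mul_one, mul_zero, Finset.sum_ite_eq, if_pos h1, if_pos h2]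
  push_cast
  field_simp
  ring

variable {Ω : Type*} {m m₀ : MeasurableSpace Ω} {P : Measure Ω} [IsProbabilityMeasure P]

lemma measure_inter_eq_zero_of_condExp (hm : m ≤ m₀) {A C : Set Ω} (hA : MeasurableSet[m] A)
    (hC : MeasurableSet C) (h : ∀ᵐ ω ∂P, ω ∈ A → (P⟦C | m⟧) ω = 0) : P (A ∩ C) = 0 := by
  have h1 : ∫ ω in A, (P⟦C | m⟧) ω ∂P = 0 := by
    rw [setIntegral_congr_ae (g := fun _ => 0) (hm A hA) h]
    simp
  rw [setIntegral_condExp hm ((integrable_const (1 : ℝ)).indicator hC) hA,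
    setIntegral_indicator hC, setIntegral_const, smul_eq_mul, mul_one] at h1
  rwa [measureReal_eq_zero_iff] at h1

variable {Δ : ℝ} {X Q : Ω → ℝ}

/-- A quantized variable lies on the grid, within `Δ` of its input. The conditional law is given
only for one fixed set at a time, so the second claim is obtained level by level. -/
lemma ae_abs_quantized_sub_le (hΔ : 0 < Δ) (hm : m ≤ m₀) (hX : Measurable[m] X)
    (hQ : Measurable Q)
    (hlaw : ∀ B : Set ℝ, MeasurableSet B →
      P⟦Q ⁻¹' B | m⟧ =ᵐ[P] fun ω => (quantLaw Δ (X ω)).real B) :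
    ∀ᵐ ω ∂P, (∃ t : ℤ, Q ω = t * Δ) ∧ |Q ω - X ω| ≤ Δ := by
  have hgrid : ∀ᵐ ω ∂P, ∃ t : ℤ, Q ω = t * Δ := by
    set B : Set ℝ := (Set.range fun t : ℤ => (t * Δ : ℝ))ᶜ with hB
    have hBm : MeasurableSet B := (Set.countable_range _).measurableSet.compl
    have h1 : P (Set.univ ∩ Q ⁻¹' B) = 0 := by
      refine measure_inter_eq_zero_of_condExp hm MeasurableSet.univ (hQ hBm) ?_
      filter_upwards [hlaw B hBm] with ω h _
      rw [h]
      exact quantLaw_real_eq_zero hΔ _ hBm fun t _ ht => ht ⟨t, rfl⟩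
    rw [Set.univ_inter] at h1
    filter_upwards [measure_eq_zero_iff_ae_notMem.1 h1] with ω h
    by_contra hcon
    exact h fun ⟨t, ht⟩ => hcon ⟨t, ht.symm⟩
  have hnear : ∀ᵐ ω ∂P, ∀ t : ℤ, ¬ (Δ < |t * Δ - X ω| ∧ Q ω = t * Δ) := by
    refine ae_all_iff.2 fun t => ?_
    have h1 : P ({ω | Δ < |t * Δ - X ω|} ∩ Q ⁻¹' {(t * Δ : ℝ)}) = 0 := by
      refine measure_inter_eq_zero_of_condExp hm ?_ (hQ (measurableSet_singleton _)) ?_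
      · exact measurableSet_lt measurable_const
          (continuous_abs.measurable.comp (measurable_const.sub hX))
      · filter_upwards [hlaw _ (measurableSet_singleton (t * Δ : ℝ))] with ω h hω
        rw [h]
        refine quantLaw_real_eq_zero hΔ _ (measurableSet_singleton _) fun s hs hst => ?_
        rw [Set.mem_singleton_iff] at hst
        rw [hst] at hs
        exact absurd hω (not_lt.2 hs)
    filter_upwards [measure_eq_zero_iff_ae_notMem.1 h1] with ω h
    exact h
  filter_upwards [hgrid, hnear] with ω ⟨t, ht⟩ h
  refine ⟨⟨t, ht⟩, ?_⟩
  by_contra hcon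
  exact h t ⟨by rw [← ht]; exact not_le.1 hcon, ht⟩

/-- The quantization error of a bounded variable has conditional mean zero. Boundedness makes the
quantized variable a finite combination of indicators of its levels. -/
lemma condExp_quantized_sub_eq_zero (hΔ : 0 < Δ) (hm : m ≤ m₀) (hX : Measurable[m] X)
    (hQ : Measurable Q)
    (hlaw : ∀ B : Set ℝ, MeasurableSet B →
      P⟦Q ⁻¹' B | m⟧ =ᵐ[P] fun ω => (quantLaw Δ (X ω)).real B)
    {R : ℝ} (hR : ∀ᵐ ω ∂P, |X ω| ≤ R) :
    P[fun ω => Q ω - X ω | m] =ᵐ[P] 0 := by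
  obtain ⟨N, hN⟩ := exists_nat_gt (R / Δ + 2)
  set s : Finset ℤ := Finset.Icc (-(N : ℤ)) N with hs
  have hmem : ∀ (y : ℝ) (t : ℤ), |y| ≤ R → |t * Δ - y| ≤ Δ → t ∈ s := by
    intro y t hy ht
    have h1 : |(t : ℝ)| * Δ ≤ (R / Δ + 2) * Δ := by
      rw [← abs_of_pos hΔ, ← abs_mul, abs_of_pos hΔ]
      have : |(t : ℝ) * Δ| ≤ |t * Δ - y| + |y| := by
        simpa using abs_add_le (t * Δ - y) y
      have h2 : (R / Δ + 2) * Δ = R + 2 * Δ := by field_simp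
      linarith
    have h2 : |(t : ℝ)| ≤ N := (le_of_mul_le_mul_right h1 hΔ).trans hN.le
    rw [hs, Finset.mem_Icc, ← abs_le]
    exact_mod_cast h2
  have hXi : Integrable X P :=
    Integrable.of_bound (hX.mono hm le_rfl).aestronglyMeasurable R hR
  have hgi : ∀ t ∈ s, Integrable ((t * Δ : ℝ) • (Q ⁻¹' {(t * Δ : ℝ)}).indicator
      fun _ => (1 : ℝ)) P := fun t _ =>
    (((integrable_const (1 : ℝ)).indicator (hQ (measurableSet_singleton _))).smul _)
  have hQsum : Q =ᵐ[P] ∑ t ∈ s, (t * Δ : ℝ) • (Q ⁻¹' {(t * Δ : ℝ)}).indicator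
      fun _ => (1 : ℝ) := by
    filter_upwards [ae_abs_quantized_sub_le hΔ hm hX hQ hlaw, hR] with ω ⟨⟨t, ht⟩, hle⟩ hRω
    have hts : t ∈ s := hmem (X ω) t hRω (by rwa [← ht])
    rw [Finset.sum_apply, Finset.sum_eq_single_of_mem t hts]
    · simp [ht]
    · intro t' _ hne
      have : ¬ (t : ℝ) = t' := fun h => hne (by exact_mod_cast h.symm)
      simp [ht, hΔ.ne', this]
  have hQi : Integrable Q P := (integrable_finsetSum' s hgi).congr hQsum.symm
  have hcond : ∀ᵐ ω ∂P, ∀ t : ℤ, (P[(t * Δ : ℝ) • (Q ⁻¹' {(t * Δ : ℝ)}).indicator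
      fun _ => (1 : ℝ) | m]) ω = (t * Δ : ℝ) * (quantLaw Δ (X ω)).real {(t * Δ : ℝ)} := by
    refine ae_all_iff.2 fun t => ?_
    filter_upwards [condExp_smul (μ := P) (t * Δ : ℝ)
      ((Q ⁻¹' {(t * Δ : ℝ)}).indicator fun _ => (1 : ℝ)) m,
      hlaw _ (measurableSet_singleton (t * Δ : ℝ))] with ω h1 h2
    rw [h1, Pi.smul_apply, h2, smul_eq_mul]
  have hsub : P[Q - X | m] =ᵐ[P] P[Q | m] - P[X | m] := condExp_sub hQi hXi m
  filter_upwards [hsub, condExp_congr_ae (m := m) hQsum, condExp_finsetSum hgi m, hcond, hR]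
    with ω h1 h2 h3 h4 h5
  have hfl : (⌊X ω / Δ⌋ : ℝ) * Δ ≤ X ω := (le_div_iff₀ hΔ).1 (Int.floor_le _)
  have hfl' : X ω < (⌊X ω / Δ⌋ + 1) * Δ := (div_lt_iff₀ hΔ).1 (Int.lt_floor_add_one _)
  change (P[Q - X | m]) ω = 0
  rw [h1, Pi.sub_apply, h2, h3, Finset.sum_apply, Finset.sum_congr rfl fun t _ => h4 t,
    sum_mul_quantLaw_real_singleton hΔ, condExp_of_stronglyMeasurable hm hX.stronglyMeasurable hXi,
    sub_self]
  · exact hmem _ _ h5 (by rw [abs_le]; constructor <;> linarith)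
  · exact hmem _ _ h5 (by push_cast; rw [abs_le]; constructor <;> linarith)

end Quantizer

/-! ### Arc maps of a graph -/

section Graph

variable {V : Type*} [Fintype V] (G : SimpleGraph V) [DecidableRel G.Adj]

lemma sum_dart_eq (f : V → V → ℝ) :
    ∑ d : G.Dart, f d.fst d.snd = ∑ i, ∑ j ∈ G.neighborFinset i, f i j := by
  rw [Finset.sum_sigma']
  refine Finset.sum_bij' (fun d _ => ⟨d.fst, d.snd⟩)
    (fun p hp => ⟨(p.1, p.2), by simpa using hp⟩) ?_ ?_ ?_ ?_ ?_
  · intro d _; simp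
  · intro p _; simp
  · intro d _; rfl
  · intro p _; rfl
  · intro d _; rfl

lemma sum_neighborFinset_comm (f : V → V → ℝ) :
    ∑ i, ∑ j ∈ G.neighborFinset i, f i j = ∑ i, ∑ j ∈ G.neighborFinset i, f j i :=
  Finset.sum_comm' fun i j => by simp [G.adj_comm]

lemma sum_sum_neighborFinset (f : V → ℝ) :
    ∑ i, ∑ j ∈ G.neighborFinset i, f j = ∑ i, (G.degree i : ℝ) * f i := by
  rw [sum_neighborFinset_comm G fun _ j => f j]
  simp

/-- The linear map from functions on the nodes to functions on the arcs whose value at the arc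
`(i, j)` is `q i + σ q j`: for `σ = -1` the transposed oriented incidence matrix, for `σ = 1` the
unoriented one. -/
noncomputable def arcMap (σ : ℝ) : EuclideanSpace ℝ V →L[ℝ] EuclideanSpace ℝ G.Dart :=
  LinearMap.toContinuousLinearMap
    { toFun := fun q => WithLp.toLp 2 fun d => q d.fst + σ * q d.snd
      map_add' := fun a b => by ext d; simp; ring
      map_smul' := fun c a => by ext d; simp; ring }

@[simp]
lemma arcMap_apply (σ : ℝ) (q : EuclideanSpace ℝ V) (d : G.Dart) :
    arcMap G σ q d = q d.fst + σ * q d.snd := rfl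

lemma inner_arcMap {σ : ℝ} (hσ : σ ^ 2 = 1) (a b : EuclideanSpace ℝ V) :
    inner ℝ (arcMap G σ a) (arcMap G σ b) =
      2 * ∑ i, b i * (G.degree i * a i + σ * ∑ j ∈ G.neighborFinset i, a j) := by
  have h1 : ∀ i j : V, (b i + σ * b j) * (a i + σ * a j) =
      b i * (a i + σ * a j) + b j * (a j + σ * a i) := fun i j => by
    linear_combination (b j * a j) * hσ
  simp only [PiLp.inner_apply, arcMap_apply, RCLike.inner_apply, conj_trivial]
  rw [sum_dart_eq G fun i j => (b i + σ * b j) * (a i + σ * a j)]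
  simp_rw [h1, Finset.sum_add_distrib]
  rw [← sum_neighborFinset_comm G fun i j => b i * (a i + σ * a j), ← two_mul]
  simp_rw [← Finset.mul_sum, Finset.sum_add_distrib, ← Finset.mul_sum]
  simp

/-- The `x`-update in coordinates, with dual variable `L β`, is an instance of the abstract
recursion: `2ρD = ρ(D - A) + ρ(D + A)`, and the arc maps factor `D - A` and `D + A`. -/
lemma weakUpdate_of_update {ρ : ℝ} {x' q β f : EuclideanSpace ℝ V}
    (h : ∀ i, (1 + 2 * ρ * G.degree i) * x' i =
      ρ * G.degree i * q i + ρ * ∑ j ∈ G.neighborFinset i, q j -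
        (G.degree i * β i - ∑ j ∈ G.neighborFinset i, β j) + f i) :
    WeakUpdate ρ (arcMap G (-1)) (arcMap G 1) f x' q β := by
  intro g
  rw [inner_arcMap G (by norm_num), inner_arcMap G (by norm_num), inner_arcMap G (by norm_num),
    inner_arcMap G (by norm_num)]
  simp only [PiLp.inner_apply, RCLike.inner_apply, conj_trivial]
  simp only [Finset.mul_sum (s := Finset.univ), ← Finset.sum_add_distrib,
    ← Finset.sum_sub_distrib]
  refine Finset.sum_congr rfl fun i _ => ?_
  linear_combination (g i) * h i

/-- Every column of the oriented incidence matrix sums to zero. -/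
lemma sum_eq_zero_of_initCondition [DecidableEq V] {α₀ : V → ℝ}
    (h : InitCondition G α₀) : ∑ i, α₀ i = 0 := by
  obtain ⟨w, rfl⟩ := h
  simp only [Matrix.mulVecLin_apply, ← Matrix.mulVec_mulVec]
  generalize (orientedIncidence G).transpose.mulVec w = u
  simp only [Matrix.mulVec, dotProduct]
  rw [Finset.sum_comm]
  refine Finset.sum_eq_zero fun d _ => ?_
  rw [← Finset.sum_mul]
  simp [orientedIncidence, sourceMatrix, targetMatrix]

end Graph

/-! ### Time averages along a path -/

section Averages

open Asymptotics

lemma isLittleO_natCast_of_bounded {u : ℕ → ℝ} {C : ℝ} (h : ∀ n, |u n| ≤ C) :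
    u =o[atTop] fun n : ℕ => (n : ℝ) := by
  have h1 : u =O[atTop] fun _ : ℕ => (1 : ℝ) :=
    IsBigO.of_bound C (Eventually.of_forall fun n => by simpa using h n)
  refine h1.trans_isLittleO ?_
  rw [isLittleO_const_left]
  right
  simpa [Function.comp_def] using tendsto_natCast_atTop_atTop (R := ℝ)

lemma tendsto_average_of_isLittleO {u : ℕ → ℝ} {a : ℝ}
    (h : (fun n => u n - n * a) =o[atTop] fun n : ℕ => (n : ℝ)) :
    Tendsto (fun n : ℕ => 1 / (n : ℝ) * u n) atTop (𝓝 a) := by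
  have h1 := h.tendsto_div_nhds_zero.add_const a
  rw [zero_add] at h1
  refine h1.congr' ?_
  filter_upwards [eventually_gt_atTop 0] with n hn
  have : (n : ℝ) ≠ 0 := by positivity
  field_simp
  ring

lemma isLittleO_sub_of_connected {V : Type*} {G : SimpleGraph V} (hG : G.Connected)
    {u : ℕ → V → ℝ} {g : ℕ → ℝ}
    (h : ∀ i j, G.Adj i j → (fun n => u n i - u n j) =o[atTop] g) (i j : V) :
    (fun n => u n i - u n j) =o[atTop] g := by
  obtain ⟨w⟩ := hG.preconnected i j
  induction w with
  | nil => simp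
  | cons hadj _ ih => simpa using (h _ _ hadj).add ih

/-- Along a bounded path of the recursion whose errors average to zero, the running averages of
`x` converge to the average of the data. -/
theorem tendsto_average_of_update {V : Type*} [Fintype V] {G : SimpleGraph V}
    [DecidableRel G.Adj] (hG : G.Connected) {ρ : ℝ} {r : V → ℝ} {x α q : ℕ → V → ℝ}
    (hα : ∀ k, ∑ i, α k i = 0)
    (hx : ∀ k i, (1 + 2 * ρ * G.degree i) * x (k + 1) i =
      ρ * G.degree i * q k i + ρ * ∑ j ∈ G.neighborFinset i, q k j - α k i + r i)
    {R : ℝ} (hxR : ∀ k i, |x k i| ≤ R)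
    (hqR : ∀ n i j, G.Adj i j →
      |∑ l ∈ Finset.range n, q (l + 1) i - ∑ l ∈ Finset.range n, q (l + 1) j| ≤ R)
    {δ : ℝ} (hδ : ∀ k i, |q k i - x k i| ≤ δ)
    (herr : ∀ i, Tendsto (fun n : ℕ => (∑ k ∈ Finset.range n, (q k i - x k i)) / n) atTop (𝓝 0))
    (i : V) :
    Tendsto (fun n : ℕ => 1 / (n : ℝ) * ∑ l ∈ Finset.Icc 1 n, x l i) atTop
      (𝓝 (1 / (Fintype.card V : ℝ) * ∑ j, r j)) := by
  set X : ℕ → V → ℝ := fun n i => ∑ l ∈ Finset.range n, x (l + 1) i with hX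
  have hXIcc : ∀ n, ∑ l ∈ Finset.Icc 1 n, x l i = X n i := fun n => by
    change _ = ∑ l ∈ Finset.range n, x (l + 1) i
    rw [Finset.range_eq_Ico, Finset.sum_Ico_add' (fun l => x l i) 0 n 1]
    rfl
  simp_rw [hXIcc]
  have hE : ∀ i, (fun n => ∑ k ∈ Finset.range n, (q k i - x k i)) =o[atTop]
      fun n : ℕ => (n : ℝ) := fun i => by
    rw [isLittleO_iff_tendsto']
    · exact herr i
    · filter_upwards [eventually_gt_atTop 0] with n hn h0
      exact absurd h0 (by positivity)
  -- shifting the summation range changes the sum by two terms only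
  have hE' : ∀ i, (fun n => ∑ k ∈ Finset.range n, (q (k + 1) i - x (k + 1) i)) =o[atTop]
      fun n : ℕ => (n : ℝ) := fun i => by
    have h1 : (fun n => (q n i - x n i) - (q 0 i - x 0 i)) =o[atTop] fun n : ℕ => (n : ℝ) :=
      isLittleO_natCast_of_bounded (C := δ + δ) fun n =>
        (abs_sub _ _).trans (add_le_add (hδ n i) (hδ 0 i))
    refine ((hE i).add h1).congr_left fun n => ?_
    have := Finset.sum_range_succ' (fun k => q k i - x k i) n
    rw [Finset.sum_range_succ] at this
    linarith
  have hXX : ∀ i j, (fun n => X n i - X n j) =o[atTop] fun n : ℕ => (n : ℝ) := by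
    refine isLittleO_sub_of_connected hG fun i j hij => ?_
    refine (((isLittleO_natCast_of_bounded fun n => hqR n i j hij).sub (hE' i)).add
      (hE' j)).congr_left fun n => ?_
    simp only [hX, Finset.sum_sub_distrib]
    ring
  -- the `x`-update summed over the nodes: the neighbor sums become weighted by degrees
  have hsum : ∀ k, ∑ i, x (k + 1) i + ∑ i, 2 * ρ * G.degree i * (x (k + 1) i - q k i) =
      ∑ i, r i := fun k => by
    have h1 := Finset.sum_congr rfl fun i (_ : i ∈ Finset.univ) => hx k i
    have h2 := sum_sum_neighborFinset G (q k)
    simp only [Finset.sum_add_distrib, Finset.sum_sub_distrib, add_mul, mul_sub, one_mul,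
      ← Finset.mul_sum, mul_assoc, hα k] at h1 h2 ⊢
    rw [h2] at h1
    linarith
  -- `∑ x (k + 1) - ∑ q k` telescopes up to the sum of the errors
  have hXr : (fun n => ∑ i, X n i - n * ∑ i, r i) =o[atTop] fun n : ℕ => (n : ℝ) := by
    have h1 : (fun n => ∑ i, (-(2 * ρ * G.degree i)) *
        ((x n i - x 0 i) - ∑ k ∈ Finset.range n, (q k i - x k i))) =o[atTop]
        fun n : ℕ => (n : ℝ) := by
      have h3 : ∀ i, (fun n => (-(2 * ρ * G.degree i)) *
          ((x n i - x 0 i) - ∑ k ∈ Finset.range n, (q k i - x k i))) =o[atTop]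
          fun n : ℕ => (n : ℝ) := fun i => by
        refine IsLittleO.const_mul_left (IsLittleO.sub ?_ (hE i)) _
        exact isLittleO_natCast_of_bounded (C := R + R) fun n =>
          (abs_sub _ _).trans (add_le_add (hxR n i) (hxR 0 i))
      refine (IsLittleO.sum fun i (_ : i ∈ Finset.univ) => h3 i).congr_left fun n => ?_
      rw [Finset.sum_apply]
    refine h1.congr_left fun n => ?_
    have h2 : (n : ℝ) * ∑ i, r i = ∑ i, X n i + ∑ i, 2 * ρ * G.degree i *
        ∑ k ∈ Finset.range n, (x (k + 1) i - q k i) := by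
      simp_rw [hX, Finset.mul_sum (s := Finset.range n)]
      rw [Finset.sum_comm, Finset.sum_comm (s := Finset.univ) (t := Finset.range n),
        ← Finset.sum_add_distrib, Finset.sum_congr rfl fun k _ => hsum k]
      simp
    rw [h2, sub_add_cancel_left, ← Finset.sum_neg_distrib]
    refine Finset.sum_congr rfl fun i _ => ?_
    have h4 := Finset.sum_range_sub (fun k => x k i) n
    rw [← h4, ← Finset.sum_sub_distrib, neg_mul]
    congr 2
    exact Finset.sum_congr rfl fun k _ => by ring
  have hV : (Fintype.card V : ℝ) ≠ 0 := by
    have : Nonempty V := ⟨i⟩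
    exact_mod_cast Fintype.card_ne_zero
  refine tendsto_average_of_isLittleO ?_
  refine (((IsLittleO.sum fun j (_ : j ∈ Finset.univ) => hXX i j).add hXr).const_mul_left
    (1 / (Fintype.card V : ℝ))).congr_left fun n => ?_
  rw [Finset.sum_apply, Finset.sum_sub_distrib, Finset.sum_const, Finset.card_univ, nsmul_eq_mul]
  field_simp
  ring

end Averages

/-! ### Runs of the quantized ADMM -/

section Run

variable {V Ω : Type*}

lemma history_mono (q : ℕ → V → Ω → ℝ) : Monotone (history q) := fun _ _ hkl =>
  iSup₂_le fun l hl => le_iSup₂_of_le l (hl.trans_le hkl) le_rfl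

lemma measurable_history (q : ℕ → V → Ω → ℝ) {l k : ℕ} (hl : l < k) (j : V) :
    Measurable[history q k] (q l j) :=
  Measurable.mono (comap_measurable (q l j))
    (le_iSup₂_of_le l hl (le_iSup (fun j => MeasurableSpace.comap (q l j) inferInstance) j)) le_rfl

lemma history_le [m₀ : MeasurableSpace Ω] {q : ℕ → V → Ω → ℝ} (hq : ∀ k i, Measurable (q k i))
    (k : ℕ) : history q k ≤ m₀ :=
  iSup₂_le fun l _ => iSup_le fun j => (hq l j).comap_le

/-- The histories before the quantizations at times `0, 1, 2, …` -/
def historyFiltration [m₀ : MeasurableSpace Ω] {q : ℕ → V → Ω → ℝ}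
    (hq : ∀ k i, Measurable (q k i)) : Filtration ℕ m₀ where
  seq := history q
  mono' := history_mono q
  le' := history_le hq

variable [Fintype V] {G : SimpleGraph V} [DecidableRel G.Adj] [MeasurableSpace Ω]
  {P : Measure Ω} {ρ Δ : ℝ} {r x₀ α₀ : V → ℝ} {x α q : ℕ → V → Ω → ℝ}

/-- The dual variable is `α₀ + L β` with `β k = ρ (q 1 + ⋯ + q k)`. -/
lemma IsPQCADMM.α_eq (h : IsPQCADMM G P ρ Δ r x₀ α₀ x α q) (k : ℕ) (i : V) (ω : Ω) :
    α k i ω = α₀ i + (G.degree i * (ρ * ∑ l ∈ Finset.range k, q (l + 1) i ω) -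
      ∑ j ∈ G.neighborFinset i, ρ * ∑ l ∈ Finset.range k, q (l + 1) j ω) := by
  induction k with
  | zero => simp [h.α_zero]
  | succ k ih =>
    rw [h.α_succ, ih]
    simp only [Finset.sum_range_succ, mul_add, Finset.sum_add_distrib, ← Finset.mul_sum]
    ring

lemma IsPQCADMM.sum_α_eq (h : IsPQCADMM G P ρ Δ r x₀ α₀ x α q) (k : ℕ) (ω : Ω) :
    ∑ i, α k i ω = ∑ i, α₀ i := by
  simp_rw [h.α_eq]
  rw [Finset.sum_add_distrib, Finset.sum_sub_distrib, sum_sum_neighborFinset G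
    fun j => ρ * ∑ l ∈ Finset.range k, q (l + 1) j ω, sub_self, add_zero]

lemma IsPQCADMM.measurable_α (h : IsPQCADMM G P ρ Δ r x₀ α₀ x α q) (k : ℕ) (i : V) :
    Measurable[history q (k + 1)] (α k i) := by
  have h1 : α k i = fun ω => α₀ i + (G.degree i * (ρ * ∑ l ∈ Finset.range k, q (l + 1) i ω) -
      ∑ j ∈ G.neighborFinset i, ρ * ∑ l ∈ Finset.range k, q (l + 1) j ω) :=
    funext fun ω => h.α_eq k i ω
  have h2 : ∀ j, Measurable[history q (k + 1)]
      fun ω => ρ * ∑ l ∈ Finset.range k, q (l + 1) j ω := fun j =>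
    (Finset.measurable_sum _ fun l hl =>
      measurable_history q (by have := Finset.mem_range.1 hl; omega) j).const_mul ρ
  rw [h1]
  exact (((h2 i).const_mul _).sub (Finset.measurable_sum _ fun j _ => h2 j)).const_add _

lemma IsPQCADMM.measurable_x (h : IsPQCADMM G P ρ Δ r x₀ α₀ x α q) (k : ℕ) (i : V) :
    Measurable[history q k] (x k i) := by
  cases k with
  | zero =>
    rw [show x 0 i = fun _ => x₀ i from funext (h.x_zero i)]
    exact measurable_const
  | succ k =>
    rw [funext (h.x_succ k i)]
    have h1 : ∀ j, Measurable[history q (k + 1)] (q k j) := fun j =>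
      measurable_history q k.lt_succ_self j
    exact (((((h1 i).const_mul _).add
      ((Finset.measurable_sum _ fun j _ => h1 j).const_mul ρ)).sub
      (h.measurable_α k i)).add_const _).const_mul _

lemma IsPQCADMM.update_eq (h : IsPQCADMM G P ρ Δ r x₀ α₀ x α q) (hρ : 0 < ρ) (k : ℕ) (i : V)
    (ω : Ω) : (1 + 2 * ρ * G.degree i) * x (k + 1) i ω =
      ρ * G.degree i * q k i ω + ρ * ∑ j ∈ G.neighborFinset i, q k j ω - α k i ω + r i := by
  have : 1 + 2 * ρ * (G.degree i : ℝ) ≠ 0 := by positivity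
  rw [h.x_succ]
  field_simp

/-- A bound on the paths whose quantization errors are at most `Δ`; it does not depend on `ω`. -/
lemma IsPQCADMM.exists_bound (h : IsPQCADMM G P ρ Δ r x₀ α₀ x α q) (hρ : 0 < ρ) :
    ∃ R : ℝ, ∀ ω, (∀ k i, |q k i ω - x k i ω| ≤ Δ) →
      (∀ k i, |x k i ω| ≤ R) ∧ ∀ n i j, G.Adj i j →
        |∑ l ∈ Finset.range n, q (l + 1) i ω - ∑ l ∈ Finset.range n, q (l + 1) j ω| ≤ R := by
  obtain ⟨R, hR⟩ := exists_bound_of_weakUpdate hρ (arcMap G (-1)) (arcMap G 1)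
    (√(Fintype.card V * Δ ^ 2)) (WithLp.toLp 2 fun i => r i - α₀ i) (WithLp.toLp 2 x₀)
  refine ⟨max R (R / ρ), fun ω hω => ?_⟩
  have hb := hR (fun k => WithLp.toLp 2 fun i => x k i ω) (fun k => WithLp.toLp 2 fun i => q k i ω)
    (fun k => WithLp.toLp 2 fun i => ρ * ∑ l ∈ Finset.range k, q (l + 1) i ω) ?_ ?_ ?_ ?_ ?_
  · refine ⟨fun k i => le_max_of_le_left ?_, fun n i j hij => le_max_of_le_right ?_⟩
    · exact (PiLp.norm_apply_le (WithLp.toLp 2 fun i => x k i ω) i).trans (hb k).1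
    · have h1 := (PiLp.norm_apply_le (arcMap G (-1) (WithLp.toLp 2 fun i =>
        ρ * ∑ l ∈ Finset.range n, q (l + 1) i ω)) ⟨(i, j), hij⟩).trans (hb n).2
      rw [arcMap_apply, Real.norm_eq_abs] at h1
      rw [le_div_iff₀ hρ, ← abs_of_pos hρ, ← abs_mul]
      refine (congrArg abs ?_).trans_le h1
      change _ = ρ * _ + -1 * (ρ * _)
      ring
  · ext i; exact h.x_zero i ω
  · ext i; simp
  · intro k
    rw [EuclideanSpace.norm_eq]
    refine Real.sqrt_le_sqrt ?_
    calc _ ≤ ∑ _i : V, Δ ^ 2 := Finset.sum_le_sum fun i _ => by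
          have := hω k i
          rw [Real.norm_eq_abs]
          exact pow_le_pow_left₀ (abs_nonneg _) this 2
      _ = _ := by simp
  · intro k
    refine weakUpdate_of_update G fun i => ?_
    have h1 := h.update_eq hρ k i ω
    rw [h.α_eq] at h1
    simp only
    linarith
  · intro k
    ext i
    simp [Finset.sum_range_succ, mul_add]

end Run

end PQCADMM

theorem mainTheorem5 {V : Type*} [Fintype V] [DecidableEq V]
    (G : SimpleGraph V) [DecidableRel G.Adj] (hG : G.Connected)
    {Ω : Type*} [MeasurableSpace Ω] (P : Measure Ω) [IsProbabilityMeasure P]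
    (ρ Δ : ℝ) (hρ : 0 < ρ) (hΔ : 0 < Δ)
    (r x₀ α₀ : V → ℝ) (hα₀ : PQCADMM.InitCondition G α₀)
    (x α q : ℕ → V → Ω → ℝ)
    (hrun : PQCADMM.IsPQCADMM G P ρ Δ r x₀ α₀ x α q) (i : V) :
    ∀ᵐ ω ∂P, Tendsto (fun k : ℕ => (1 / (k : ℝ)) * ∑ l ∈ Finset.Icc 1 k, x l i ω) atTop
      (𝓝 ((1 / (Fintype.card V : ℝ)) * ∑ j, r j)) := by
  open PQCADMM in
  have hle := history_le hrun.measurable_quant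
  have herr : ∀ᵐ ω ∂P, ∀ k j, |q k j ω - x k j ω| ≤ Δ :=
    ae_all_iff.2 fun k => ae_all_iff.2 fun j => (ae_abs_quantized_sub_le hΔ (hle k)
      (hrun.measurable_x k j) (hrun.measurable_quant k j) (hrun.quant_law k j)).mono
      fun ω h => h.2
  obtain ⟨R, hR⟩ := hrun.exists_bound hρ
  have hlln : ∀ j, ∀ᵐ ω ∂P, Tendsto
      (fun n : ℕ => (∑ k ∈ Finset.range n, (q k j ω - x k j ω)) / n) atTop (𝓝 0) := fun j =>
    ae_tendsto_average_zero_of_martingaleDifference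
      (ℱ := historyFiltration hrun.measurable_quant) (e := fun k ω => q k j ω - x k j ω) (c := Δ)
      (fun k => (measurable_history q k.lt_succ_self j).sub
        ((hrun.measurable_x k j).mono (history_mono q k.le_succ) le_rfl))
      (fun k => herr.mono fun ω h => h k j)
      (fun k => condExp_quantized_sub_eq_zero hΔ (hle k) (hrun.measurable_x k j)
        (hrun.measurable_quant k j) (hrun.quant_law k j)
        (herr.mono fun ω h => (hR ω h).1 k j))
  filter_upwards [herr, ae_all_iff.2 hlln] with ω h1 h2
  exact tendsto_average_of_update hG
    (fun k => (hrun.sum_α_eq k ω).trans (sum_eq_zero_of_initCondition G hα₀))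
    (fun k j => hrun.update_eq hρ k j ω) (hR ω h1).1 (hR ω h1).2 h1 h2 i
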